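/- Let $d,w\ge 0$ be integers. Let $p_\infty,p_1:\mathbb{R}^d\to(0,\infty)$ be strictly positive, twice continuously differentiable probability densities with respect to Lebesgue measure, of distributions $P_\infty\neq P_1$, and let $\mathbb{E}_\infty,\mathbb{E}_1$ be the corresponding expectations of a single observation $X$. Let $m:\mathbb{R}^d\to\mathbb{R}^{d\times w}$ be a matrix-valued function. For distributions $P,Q\in\{P_\infty,P_1\}$ with densities $p,q$ put $$\mathbb{D}_m(P\|Q)=\mathbb{E}_{X\sim P}\Big[\tfrac12\big\|m^T(X)\big(\nabla\log p(X)-\nabla\log q(X)\big)\big\|_2^2\Big],$$ $$\mathcal{S}_m(X,P)=\tfrac12\big\|m^T(X)\nabla\log p(X)\big\|_2^2+\nabla\cdot\big(m\,m^T\,\nabla\log p\big)(X),\qquad Z_m(X)=\mathcal{S}_m(X,P_\infty)-\mathcal{S}_m(X,P_1),$$ where $\nabla\cdot f=\sum_i\partial f_i/\partial X_i$. Assume that: 1. for $(R,S)\in\{(P_\infty,P_1),(P_1,P_\infty)\}$ with densities $r,s$: $m$ and $\nabla\log s$ are continuously differentiable, $\mathbb{E}_R[\|m^T(X)\nabla\log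 s(X)\|^2]<\infty$, $\mathbb{E}_R[\|m^T(X)\nabla\log r(X)\|^2]<\infty$, and $s(X)\,m(X)m^T(X)\nabla\log r(X)\to0$ as $\|X\|\to\infty$; 2. $\mathbb{D}_m(P_\infty\|P_1)>0$ and $\mathbb{D}_m(P_1\|P_\infty)>0$; 3. $\mathbb{E}_1[\mathcal{S}_m(X,P_\infty)^2]<\infty$ and $\mathbb{E}_1[\mathcal{S}_m(X,P_1)^2]<\infty$. For an integer $\nu\ge1$ let $\mathbb{E}_\nu$ be the expectation for a data stream $X_1,X_2,\dots$ of independent observations with $X_i\sim P_\infty$ for $i<\nu$ and $X_i\sim P_1$ for $i\ge\nu$, and let $\mathcal{F}_{\nu-1}=\sigma(X_1,\dots,X_{\nu-1})$. For $c>0$ define the diffusion CUSUM rule by $$Y_m(0)=0,\qquad Y_m(t)=\max\big(0,\,Y_m(t-1)+Z_m(X_t)\big)\ (t\ge1),\qquad \tau_m^c=\min\{t\in\mathbb{N}:Y_m(t)\ge c\}$$ (with $\tau_m^c=\infty$ if no such $t$ exists), and for a stopping rule $\tau$ define the worst-case average detection delay $$\mathcal{L}_{\mathrm{WADD}}(\tau)=\sup_{\nu\ge1}\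 \operatorname{ess\,sup}\ \mathbb{E}_\nu\big[(\tau-\nu+1)^+\,\big|\,\mathcal{F}_{\nu-1}\big]\in[0,\infty].$$ Then $$\mathcal{L}_{\mathrm{WADD}}(\tau_m^c)\sim\frac{c}{\mathbb{D}_m(P_1\|P_\infty)}\quad\text{as }c\to\infty,\qquad\text{i.e.}\qquad \lim_{c\to\infty}\frac{\mathcal{L}_{\mathrm{WADD}}(\tau_m^c)}{c/\mathbb{D}_m(P_1\|P_\infty)}=1 .$$ -/

import Mathlib

open MeasureTheory Filter Topology
open scoped ENNReal Matrix

noncomputable section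

namespace DiffusionCusum

/-- The sample space `ℝ^d` with its Euclidean norm. -/
abbrev E (d : ℕ) : Type := EuclideanSpace ℝ (Fin d)

/-- A probability density on `ℝ^d` with respect to Lebesgue measure which is twice continuously
differentiable and supported on all of `ℝ^d`, i.e. positive everywhere (so that `log p` and its
gradient make sense at every point). -/
structure Density (d : ℕ) where
  toFun : E d → ℝ
  pos : ∀ x, 0 < toFun x
  contDiff : ContDiff ℝ 2 toFun
  lintegral_eq_one : ∫⁻ x, ENNReal.ofReal (toFun x) = 1

instance (d : ℕ) : CoeFun (Density d) (fun _ => E d → ℝ) := ⟨Density.toFun⟩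

/-- The probability distribution with density `p`. -/
def Density.law {d : ℕ} (p : Density d) : Measure (E d) :=
  volume.withDensity (fun x => ENNReal.ofReal (p x))

instance {d : ℕ} (p : Density d) : IsProbabilityMeasure p.law :=
  ⟨by simpa [Density.law] using p.lintegral_eq_one⟩

/-- The score `∇ log p (x)`. -/
def score {d : ℕ} (p : Density d) (x : E d) : E d :=
  gradient (fun y => Real.log (p y)) x

/-- The vector `mᵀ(x) v ∈ ℝ^w`. -/
def mT {d w : ℕ} (m : E d → Matrix (Fin d) (Fin w) ℝ) (x v : E d) : E w :=
  WithLp.toLp 2 ((m x)ᵀ *ᵥ v.ofLp)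

/-- The vector `m(x) mᵀ(x) v ∈ ℝ^d`. -/
def mmT {d w : ℕ} (m : E d → Matrix (Fin d) (Fin w) ℝ) (x v : E d) : E d :=
  WithLp.toLp 2 ((m x * (m x)ᵀ) *ᵥ v.ofLp)

/-- The divergence `∑ᵢ ∂fᵢ/∂xᵢ` of a vector field on `ℝ^d`. -/
def divergence {d : ℕ} (f : E d → E d) (x : E d) : ℝ :=
  ∑ i : Fin d, (fderiv ℝ f x (EuclideanSpace.single i 1)) i

/-- The diffusion divergence `𝔻_m(P‖Q) = E_{X∼P} [½ ‖mᵀ(X) (∇ log p(X) - ∇ log q(X))‖²]`,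
with values in `[0, ∞]`. -/
def diffusionDivergence {d w : ℕ} (m : E d → Matrix (Fin d) (Fin w) ℝ) (p q : Density d) : ℝ≥0∞ :=
  ∫⁻ x, ENNReal.ofReal (1 / 2 * ‖mT m x (score p x - score q x)‖ ^ 2) ∂p.law

/-- The diffusion-Hyvärinen score
`S_m(x, P) = ½ ‖mᵀ(x) ∇ log p(x)‖² + ∇ · (m mᵀ ∇ log p)(x)`. -/
def hyvScore {d w : ℕ} (m : E d → Matrix (Fin d) (Fin w) ℝ) (p : Density d) (x : E d) : ℝ :=
  1 / 2 * ‖mT m x (score p x)‖ ^ 2 + divergence (fun y => mmT m y (score p y)) x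

/-- The instantaneous detection score `Z_m(x) = S_m(x, P_∞) - S_m(x, P_1)`. -/
def detScore {d w : ℕ} (m : E d → Matrix (Fin d) (Fin w) ℝ) (pInf p1 : Density d) (x : E d) : ℝ :=
  hyvScore m pInf x - hyvScore m p1 x

/-- The diffusion-Hyvärinen regularity conditions for an ordered pair of distributions with
densities `r, s`. -/
structure RegularPair {d w : ℕ} (m : E d → Matrix (Fin d) (Fin w) ℝ) (r s : Density d) :
    Prop where
  contDiff_m : ∀ i j, ContDiff ℝ 1 (fun x => m x i j)
  contDiff_score : ContDiff ℝ 1 (score s)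
  moment_s : ∫⁻ x, ENNReal.ofReal (‖mT m x (score s x)‖ ^ 2) ∂r.law < ∞
  moment_r : ∫⁻ x, ENNReal.ofReal (‖mT m x (score r x)‖ ^ 2) ∂r.law < ∞
  vanish : Tendsto (fun x => s x • mmT m x (score r x)) (cocompact (E d)) (𝓝 0)

/-- A data stream `X₁, X₂, …`, indexed by the positive integers. -/
abbrev Stream (d : ℕ) : Type := ℕ+ → E d

/-- The cumulative detection score `Y(0) = 0`, `Y(t + 1) = max (0, Y(t) + Z(X_{t+1}))`. -/
def cusum {d : ℕ} (Z : E d → ℝ) (X : Stream d) : ℕ → ℝ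
  | 0 => 0
  | t + 1 => max 0 (cusum Z X t + Z (X t.succPNat))

/-- The stopping rule `min {t : Y(t) ≥ c}`, with value `∞` if the threshold is never reached. -/
def stoppingRule {d : ℕ} (Z : E d → ℝ) (c : ℝ) (X : Stream d) : ℕ∞ :=
  ⨅ (t : ℕ) (_ : c ≤ cusum Z X t), (t : ℕ∞)

instance {d : ℕ} (P Q : Measure (E d)) [IsProbabilityMeasure P] [IsProbabilityMeasure Q]
    (ν i : ℕ+) : IsProbabilityMeasure (if i < ν then P else Q) := by
  split_ifs <;> infer_instance

/-- The law of a stream of independent observations with change point `ν`: `X_i ∼ P` for `i < ν`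
and `X_i ∼ Q` for `i ≥ ν`. -/
def streamLaw {d : ℕ} (P Q : Measure (E d)) [IsProbabilityMeasure P] [IsProbabilityMeasure Q]
    (ν : ℕ+) : Measure (Stream d) :=
  Measure.infinitePi (fun i : ℕ+ => if i < ν then P else Q)

/-- The σ-algebra `F_{ν-1}` generated by the observations `X_i`, `i < ν`. -/
abbrev past (d : ℕ) (ν : ℕ+) : MeasurableSpace (Stream d) :=
  ⨆ (i : ℕ+) (_ : i < ν), MeasurableSpace.comap (fun X : Stream d => X i) inferInstance

/-- The delay `(τ - ν + 1)⁺ ∈ [0, ∞]`; subtraction on `ℕ∞` is truncated at `0`. -/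
def delay (τ : ℕ∞) (ν : ℕ+) : ℝ≥0∞ := ((τ + 1 - ((ν : ℕ) : ℕ∞) : ℕ∞) : ℝ≥0∞)

/-- The worst-case average detection delay
`sup_{ν ≥ 1} ess sup E_ν [(τ - ν + 1)⁺ | F_{ν-1}]`, with values in `[0, ∞]`. -/
def wadd {d : ℕ} (P Q : Measure (E d)) [IsProbabilityMeasure P] [IsProbabilityMeasure Q]
    (τ : Stream d → ℕ∞) : ℝ≥0∞ :=
  ⨆ ν : ℕ+, essSup (condLExp (past d ν) (streamLaw P Q ν) (fun X => delay (τ X) ν))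
    (streamLaw P Q ν)

end DiffusionCusum

end

open DiffusionCusum

namespace DiffusionCusum

/-! The theorem separates into a fact about the increments and a renewal-type fact about CUSUM.

Mean of the increments. Expanding the square in `diffusionDivergence m p1 pInf` and removing the
cross terms by Stein's identity, E_p[∇·V + ⟨∇ log p, V⟩] = 0, shows that Z has post-change mean D,
the divergence. Decay of pV at infinity does not by itself kill the boundary term, since spheres
grow. `integral_stein_eq_zero` therefore cuts off along level sets of log-densities: the derivative
of such a cutoff along V is O(1/n) times ⟨∇ log p, V⟩, which is integrable (`exists_cutoff`).

Run length. The recursion is monotone in its current value, so a statistic of zero at the change is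
the worst past. A restarted rule sees only post-change data, independent of the past. Hence the
worst-case delay is E[τ] for an i.i.d. post-change stream (`wadd_stoppingRule`), and E[τ] ~ c/D
remains to be shown. Above, Wald's identity is applied to the increments truncated at M, whose
overshoot is at most M (`lintegral_stoppingRule_le`). Below, the strong law keeps the walk near the
line of slope D with high probability, so CUSUM cannot reach c much before c/D
(`exists_le_lintegral_stoppingRule`). -/

/-! ### Integration by parts and cutoff functions -/

lemma exists_abs_deriv_smoothTransition_le :
    ∃ C : ℝ, 0 ≤ C ∧ ∀ x, |deriv Real.smoothTransition x| ≤ C := by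
  have hcont : Continuous (deriv Real.smoothTransition) :=
    (Real.smoothTransition.contDiff (n := 1)).continuous_deriv le_rfl
  obtain ⟨C, hC⟩ := (isCompact_Icc (a := (0 : ℝ)) (b := 1)).exists_bound_of_continuousOn
    hcont.continuousOn
  refine ⟨max C 0, le_max_right _ _, fun x => ?_⟩
  rcases lt_or_ge x 0 with hx | hx
  · have : Real.smoothTransition =ᶠ[𝓝 x] fun _ => 0 := by
      filter_upwards [Iio_mem_nhds hx] with y hy
      exact Real.smoothTransition.zero_of_nonpos hy.le
    simp [this.deriv_eq]
  rcases lt_or_ge 1 x with hx' | hx'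
  · have : Real.smoothTransition =ᶠ[𝓝 x] fun _ => 1 := by
      filter_upwards [Ioi_mem_nhds hx'] with y hy
      exact Real.smoothTransition.one_of_one_le hy.le
    simp [this.deriv_eq]
  · exact (hC x ⟨hx, hx'⟩).trans (le_max_left _ _)

lemma continuous_divergence {d : ℕ} {V : E d → E d} (hV : ContDiff ℝ 1 V) :
    Continuous (divergence V) := by
  have h := hV.continuous_fderiv (by simp)
  unfold divergence
  fun_prop

/-- Integration by parts against a compactly supported test function. -/
lemma integral_mul_divergence {d : ℕ} {ψ : E d → ℝ} {V : E d → E d} (hψ : ContDiff ℝ 1 ψ)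
    (hc : HasCompactSupport ψ) (hV : ContDiff ℝ 1 V) :
    ∫ x, ψ x * divergence V x = -∫ x, fderiv ℝ ψ x (V x) := by
  have hVi : ∀ i, ContDiff ℝ 1 fun x => V x i := fun i => by fun_prop
  have hψ' := hψ.continuous_fderiv (by simp)
  have hc' : HasCompactSupport (fderiv ℝ ψ) := hc.fderiv ℝ
  have hfd : ∀ i x v, fderiv ℝ (fun y => V y i) x v = fderiv ℝ V x v i := fun i x v => by
    have h := (hV.differentiable (by simp) x).hasFDerivAt
    have h2 := (EuclideanSpace.proj (𝕜 := ℝ) i).hasFDerivAt.comp x h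
    have h3 : HasFDerivAt (fun y => V y i)
      ((EuclideanSpace.proj (𝕜 := ℝ) i).comp (fderiv ℝ V x)) x := h2
    rw [h3.fderiv]; rfl
  have hint1 : ∀ i : Fin d, Integrable
      (fun x => ψ x * fderiv ℝ (fun y => V y i) x (EuclideanSpace.single i 1)) := fun i => by
    refine Continuous.integrable_of_hasCompactSupport ?_ hc.mul_right
    have := (hVi i).continuous_fderiv (by simp)
    have := hψ.continuous
    fun_prop
  have hint2 : ∀ i : Fin d, Integrable
      (fun x => fderiv ℝ ψ x (EuclideanSpace.single i 1) * V x i) := fun i => by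
    refine Continuous.integrable_of_hasCompactSupport ?_ ?_
    · have := (hVi i).continuous
      fun_prop
    · refine HasCompactSupport.mul_right (hc'.comp_left (g := fun L : E d →L[ℝ] ℝ =>
        L (EuclideanSpace.single i 1)) (by simp))
  have hexp : ∀ x, fderiv ℝ ψ x (V x)
      = ∑ i, fderiv ℝ ψ x (EuclideanSpace.single i 1) * V x i := fun x => by
    conv_lhs => rw [← (EuclideanSpace.basisFun (Fin d) ℝ).sum_repr (V x)]
    simp [mul_comm]
  simp_rw [divergence, Finset.mul_sum, hexp, ← hfd]
  rw [integral_finsetSum _ fun i _ => hint1 i, integral_finsetSum _ fun i _ => hint2 i,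
    ← Finset.sum_neg_distrib]
  refine Finset.sum_congr rfl fun i _ => ?_
  refine integral_mul_fderiv_eq_neg_fderiv_mul_of_integrable (hint2 i) (hint1 i) ?_
    (fun x _ => hψ.differentiable (by simp) x) (fun x _ => (hVi i).differentiable (by simp) x)
  exact Continuous.integrable_of_hasCompactSupport
    (hψ.continuous.mul (hVi i).continuous) hc.mul_right

/-- Cutting off in the values of u₁ and u₂ costs only their derivatives along V, divided by n + 1.
The sets left over need not be compact, so a spatial bump is added; V is bounded on them, so a large
enough radius makes its cost O(1/n) too. -/
lemma exists_cutoff {d : ℕ} {u₁ u₂ : E d → ℝ} {V : E d → E d} (hu₁ : ContDiff ℝ 1 u₁)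
    (hu₂ : ContDiff ℝ 1 u₂)
    (hV : ∀ N : ℝ, ∃ C, ∀ x, -N ≤ u₁ x → -N ≤ u₂ x → ‖V x‖ ≤ C) :
    ∃ C : ℝ, ∃ ψ : ℕ → E d → ℝ, (∀ n, ContDiff ℝ 1 (ψ n)) ∧ (∀ n, HasCompactSupport (ψ n)) ∧
      (∀ n x, |ψ n x| ≤ 1) ∧ (∀ x, ∀ᶠ n in atTop, ψ n x = 1) ∧
      ∀ n x, |fderiv ℝ (ψ n) x (V x)| ≤
        C / ((n : ℝ) + 1) * (|fderiv ℝ u₁ x (V x)| + |fderiv ℝ u₂ x (V x)| + 1) := by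
  obtain ⟨A, hA0, hA⟩ := exists_abs_deriv_smoothTransition_le
  let χ : ContDiffBump (0 : E d) := ⟨1, 2, by norm_num, by norm_num⟩
  have hχ : ContDiff ℝ 1 χ := χ.contDiff
  obtain ⟨B, hB⟩ := (hχ.continuous_fderiv (by simp)).bounded_above_of_compact_support
    (χ.hasCompactSupport.fderiv ℝ)
  have hB0 : 0 ≤ B := (norm_nonneg _).trans (hB 0)
  choose K hK using hV
  -- The factor K beats the bound on V where both uᵢ ≥ -2(n+1), the factor n + 1 supplies the decay,
  -- and the summand 1 gives R n ≥ n, so that the bumps exhaust the space.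
  let R : ℕ → ℝ := fun n => ((n : ℝ) + 1) * (|K (2 * ((n : ℝ) + 1))| + 1)
  have hn : ∀ n : ℕ, (0 : ℝ) < (n : ℝ) + 1 := fun n => by positivity
  have hR : ∀ n, 0 < R n := fun n => by positivity
  have hRn : ∀ n : ℕ, (n : ℝ) ≤ R n := fun n => by
    have := abs_nonneg (K (2 * ((n : ℝ) + 1)))
    have := hn n
    simp only [R]
    nlinarith
  -- Equal to 1 where u ≥ -(n+1) and to 0 where u ≤ -2(n+1).
  let a : (E d → ℝ) → ℕ → E d → ℝ := fun u n x =>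
    Real.smoothTransition (((n : ℝ) + 1)⁻¹ * u x + 2)
  have ha : ∀ u, ContDiff ℝ 1 u → ∀ n, ContDiff ℝ 1 (a u n) := fun u hu n => by
    have h : ContDiff ℝ 1 Real.smoothTransition := Real.smoothTransition.contDiff (n := 1)
    exact h.comp ((contDiff_const.mul hu).add contDiff_const)
  have ha0 : ∀ u n x, 0 ≤ a u n x := fun u n x => Real.smoothTransition.nonneg _
  have ha1 : ∀ u n x, a u n x ≤ 1 := fun u n x => Real.smoothTransition.le_one _
  have haz : ∀ u (n : ℕ) x, u x < -(2 * ((n : ℝ) + 1)) → a u n x = 0 := fun u n x h => by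
    refine Real.smoothTransition.zero_of_nonpos ?_
    have h1 : ((n : ℝ) + 1)⁻¹ * u x ≤ ((n : ℝ) + 1)⁻¹ * -(2 * ((n : ℝ) + 1)) :=
      mul_le_mul_of_nonneg_left h.le (by positivity)
    have h2 : ((n : ℝ) + 1)⁻¹ * -(2 * ((n : ℝ) + 1)) = -2 := by
      have := (hn n).ne'
      field_simp
    linarith
  have hae : ∀ u x, ∀ᶠ n in atTop, a u n x = 1 := fun u x => by
    filter_upwards [eventually_ge_atTop ⌈-u x⌉₊] with n h
    refine Real.smoothTransition.one_of_one_le ?_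
    have h0 : -u x ≤ n := (Nat.le_ceil _).trans (by exact_mod_cast h)
    have h1 : ((n : ℝ) + 1)⁻¹ * -((n : ℝ) + 1) ≤ ((n : ℝ) + 1)⁻¹ * u x :=
      mul_le_mul_of_nonneg_left (by linarith) (by positivity)
    have h2 : ((n : ℝ) + 1)⁻¹ * -((n : ℝ) + 1) = -1 := by
      have := (hn n).ne'
      field_simp
    linarith
  have had : ∀ u, ContDiff ℝ 1 u → ∀ n x v,
      |fderiv ℝ (a u n) x v| ≤ A / ((n : ℝ) + 1) * |fderiv ℝ u x v| := fun u hu n x v => by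
    have h1 : HasDerivAt Real.smoothTransition
        (deriv Real.smoothTransition (((n : ℝ) + 1)⁻¹ * u x + 2)) (((n : ℝ) + 1)⁻¹ * u x + 2) :=
      ((Real.smoothTransition.contDiff (n := 1)).differentiable (by simp) _).hasDerivAt
    have h2 : HasFDerivAt (fun x => ((n : ℝ) + 1)⁻¹ * u x + 2)
        (((n : ℝ) + 1)⁻¹ • fderiv ℝ u x) x :=
      ((hu.differentiable (by simp) x).hasFDerivAt.const_mul _).add_const _
    have h3 := h1.comp_hasFDerivAt x h2
    have h4 : fderiv ℝ (a u n) x = _ := h3.fderiv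
    rw [h4]
    simp only [smul_apply, smul_eq_mul, abs_mul, abs_inv, abs_of_pos (hn n)]
    rw [div_eq_mul_inv, mul_assoc]
    exact mul_le_mul_of_nonneg_right (hA _) (by positivity)
  let b : ℕ → E d → ℝ := fun n x => χ ((R n)⁻¹ • x)
  have hb : ∀ n, ContDiff ℝ 1 (b n) := fun n => hχ.comp (contDiff_const_smul _)
  have hb0 : ∀ n x, 0 ≤ b n x := fun n x => χ.nonneg
  have hb1 : ∀ n x, b n x ≤ 1 := fun n x => χ.le_one
  have hbc : ∀ n, HasCompactSupport (b n) := fun n =>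
    χ.hasCompactSupport.comp_smul (inv_ne_zero (hR n).ne')
  have hbe : ∀ x, ∀ᶠ n in atTop, b n x = 1 := fun x => by
    filter_upwards [eventually_ge_atTop ⌈‖x‖⌉₊] with n h
    refine χ.one_of_mem_closedBall ?_
    have h0 : ‖x‖ ≤ n := (Nat.le_ceil _).trans (by exact_mod_cast h)
    rw [mem_closedBall_zero_iff, norm_smul, norm_inv, Real.norm_of_nonneg (hR n).le]
    exact inv_mul_le_one_of_le₀ (h0.trans (hRn n)) (hR n).le
  have hbd : ∀ n x v, |fderiv ℝ (b n) x v| ≤ B / R n * ‖v‖ := fun n x v => by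
    have h1 : HasFDerivAt (fun x : E d => (R n)⁻¹ • x)
        ((R n)⁻¹ • ContinuousLinearMap.id ℝ (E d)) x :=
      ((R n)⁻¹ • ContinuousLinearMap.id ℝ (E d)).hasFDerivAt
    have h2 := (hχ.differentiable (by simp) ((R n)⁻¹ • x)).hasFDerivAt.comp x h1
    have h4 : fderiv ℝ (b n) x = _ := h2.fderiv
    rw [h4]
    simp only [ContinuousLinearMap.comp_apply, smul_apply,
      ContinuousLinearMap.id_apply, map_smul, smul_eq_mul, abs_mul, abs_inv, abs_of_pos (hR n)]
    have := (fderiv ℝ χ ((R n)⁻¹ • x)).le_of_opNorm_le (hB _) v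
    rw [Real.norm_eq_abs] at this
    calc _ ≤ (R n)⁻¹ * (B * ‖v‖) := mul_le_mul_of_nonneg_left this (inv_nonneg.2 (hR n).le)
      _ = _ := by ring
  refine ⟨A + B, fun n x => a u₁ n x * a u₂ n x * b n x,
    fun n => ((ha _ hu₁ n).mul (ha _ hu₂ n)).mul (hb n), fun n => (hbc n).mul_left,
    fun n x => ?_, fun x => ?_, fun n x => ?_⟩
  · rw [abs_of_nonneg (mul_nonneg (mul_nonneg (ha0 _ _ _) (ha0 _ _ _)) (hb0 _ _))]
    exact mul_le_one₀ (mul_le_one₀ (ha1 _ _ _) (ha0 _ _ _) (ha1 _ _ _)) (hb0 _ _) (hb1 _ _)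
  · filter_upwards [hae u₁ x, hae u₂ x, hbe x] with n h1 h2 h3
    simp [h1, h2, h3]
  · have hd : ∀ u, ContDiff ℝ 1 u → HasFDerivAt (a u n) (fderiv ℝ (a u n) x) x := fun u hu =>
      ((ha _ hu n).differentiable (by simp) x).hasFDerivAt
    have hd3 : HasFDerivAt (b n) (fderiv ℝ (b n) x) x :=
      ((hb n).differentiable (by simp) x).hasFDerivAt
    have hfd : fderiv ℝ (fun x => a u₁ n x * a u₂ n x * b n x) x = _ :=
      (((hd u₁ hu₁).mul (hd u₂ hu₂)).mul hd3).fderiv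
    beta_reduce
    rw [hfd]
    simp only [add_apply, smul_apply, smul_eq_mul]
    have e1 := had u₁ hu₁ n x (V x)
    have e2 := had u₂ hu₂ n x (V x)
    have e3 : |a u₁ n x * a u₂ n x * fderiv ℝ (b n) x (V x)| ≤ B / ((n : ℝ) + 1) := by
      by_cases hx : -(2 * ((n : ℝ) + 1)) ≤ u₁ x ∧ -(2 * ((n : ℝ) + 1)) ≤ u₂ x
      · have hv := hK _ x hx.1 hx.2
        have haa : |a u₁ n x * a u₂ n x| ≤ 1 := by
          rw [abs_of_nonneg (mul_nonneg (ha0 _ _ _) (ha0 _ _ _))]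
          exact mul_le_one₀ (ha1 _ _ _) (ha0 _ _ _) (ha1 _ _ _)
        rw [abs_mul]
        calc _ ≤ 1 * (B / R n * ‖V x‖) :=
              mul_le_mul haa (hbd n x _) (abs_nonneg _) zero_le_one
          _ ≤ 1 * (B / R n * (|K (2 * ((n : ℝ) + 1))| + 1)) := by
              have := hR n
              have := le_abs_self (K (2 * ((n : ℝ) + 1)))
              gcongr
              linarith
          _ = B / ((n : ℝ) + 1) := by
              simp only [R]
              have := hn n
              field_simp
      · have h0 : a u₁ n x * a u₂ n x = 0 := by
          rw [not_and_or, not_le, not_le] at hx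
          rcases hx with h | h
          · simp [haz _ _ _ h]
          · simp [haz _ _ _ h]
        rw [h0]
        simp only [zero_mul, abs_zero]
        positivity
    set D₁ := fderiv ℝ (a u₁ n) x (V x)
    set D₂ := fderiv ℝ (a u₂ n) x (V x)
    set D₃ := fderiv ℝ (b n) x (V x)
    have m1 : |b n x * (a u₂ n x * D₁)| ≤ |D₁| := by
      rw [← mul_assoc, abs_mul, abs_of_nonneg (mul_nonneg (hb0 _ _) (ha0 _ _ _))]
      exact mul_le_of_le_one_left (abs_nonneg _)
        (mul_le_one₀ (hb1 _ _) (ha0 _ _ _) (ha1 _ _ _))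
    have m2 : |b n x * (a u₁ n x * D₂)| ≤ |D₂| := by
      rw [← mul_assoc, abs_mul, abs_of_nonneg (mul_nonneg (hb0 _ _) (ha0 _ _ _))]
      exact mul_le_of_le_one_left (abs_nonneg _)
        (mul_le_one₀ (hb1 _ _) (ha0 _ _ _) (ha1 _ _ _))
    have hAB : (A + B) / ((n : ℝ) + 1) = A / ((n : ℝ) + 1) + B / ((n : ℝ) + 1) := by ring
    have p1 : 0 ≤ A / ((n : ℝ) + 1) := by positivity
    have p2 : 0 ≤ B / ((n : ℝ) + 1) := by positivity
    calc _ ≤ |a u₁ n x * a u₂ n x * D₃|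
          + (|b n x * (a u₁ n x * D₂)| + |b n x * (a u₂ n x * D₁)|) := by
          rw [mul_add]
          exact (abs_add_le _ _).trans (add_le_add le_rfl (abs_add_le _ _))
      _ ≤ B / ((n : ℝ) + 1) + (A / ((n : ℝ) + 1) * |fderiv ℝ u₂ x (V x)|
          + A / ((n : ℝ) + 1) * |fderiv ℝ u₁ x (V x)|) :=
        add_le_add e3 (add_le_add (m2.trans e2) (m1.trans e1))
      _ ≤ _ := by
        rw [hAB]
        have q1 := mul_nonneg p2 (abs_nonneg (fderiv ℝ u₁ x (V x)))
        have q2 := mul_nonneg p2 (abs_nonneg (fderiv ℝ u₂ x (V x)))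
        nlinarith

/-! ### Stein's identity -/

lemma Density.integral_law {d : ℕ} (p : Density d) (f : E d → ℝ) :
    ∫ x, f x ∂p.law = ∫ x, p x * f x := by
  have hm : Measurable fun x => ENNReal.ofReal (p x) :=
    p.contDiff.continuous.measurable.ennreal_ofReal
  rw [Density.law, integral_withDensity_eq_integral_toReal_smul hm (by simp)]
  simp [ENNReal.toReal_ofReal (p.pos _).le]

lemma Density.contDiff_log {d : ℕ} (p : Density d) : ContDiff ℝ 1 fun x => Real.log (p x) :=
  (p.contDiff.log fun x => (p.pos x).ne').of_le (by norm_num)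

lemma inner_score {d : ℕ} (p : Density d) (x v : E d) :
    inner ℝ (score p x) v = fderiv ℝ (fun y => Real.log (p y)) x v :=
  inner_gradient_left

/-- The mean of the Stein operator `∇ · V + ⟨∇ log p, V⟩` vanishes, provided the flux of `V` across
the level sets of `p` and of a second density is integrable and `V` is bounded where both
densities are bounded below. -/
lemma integral_stein_eq_zero {d : ℕ} (p q : Density d) {V : E d → E d} (hV : ContDiff ℝ 1 V)
    (hp : Integrable (fun x => inner ℝ (score p x) (V x)) p.law)
    (hq : Integrable (fun x => inner ℝ (score q x) (V x)) p.law)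
    (hdiv : Integrable (divergence V) p.law)
    (hbd : ∀ N : ℝ, ∃ C, ∀ x, -N ≤ Real.log (p x) → -N ≤ Real.log (q x) → ‖V x‖ ≤ C) :
    ∫ x, (divergence V x + inner ℝ (score p x) (V x)) ∂p.law = 0 := by
  obtain ⟨C, ψ, hψ, hψc, hψ1, hψe, hψd⟩ := exists_cutoff p.contDiff_log q.contDiff_log hbd
  set G : E d → ℝ := fun x => divergence V x + inner ℝ (score p x) (V x) with hG
  set H : E d → ℝ := fun x => |inner ℝ (score p x) (V x)| + |inner ℝ (score q x) (V x)| + 1 with hH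
  have hGi : Integrable G p.law := hdiv.add hp
  have hHi : Integrable H p.law := (hp.abs.add hq.abs).add (integrable_const _)
  have hpC : ContDiff ℝ 1 p := p.contDiff.of_le (by norm_num)
  have hfp : ∀ x v, fderiv ℝ p x v = p x * inner ℝ (score p x) v := fun x v => by
    have h1 : HasFDerivAt (fun y => Real.log (p y)) ((p x)⁻¹ • fderiv ℝ p x) x :=
      (hpC.differentiable (by simp) x).hasFDerivAt.log (p.pos x).ne'
    rw [inner_score, h1.fderiv, smul_apply, smul_eq_mul,
      mul_inv_cancel_left₀ (p.pos x).ne']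
  -- Integration by parts with test function ψp: since ∇p = p ∇ log p, the derivative of p completes
  -- the Stein operator and only the derivative of ψ is left over.
  have key : ∀ n, ∫ x, ψ n x * G x ∂p.law = -∫ x, fderiv ℝ (ψ n) x (V x) ∂p.law := fun n => by
    have hψp : ContDiff ℝ 1 fun x => ψ n x * p x := (hψ n).mul hpC
    have h1 := integral_mul_divergence hψp (hψc n).mul_right hV
    have h2 : ∀ x, fderiv ℝ (fun x => ψ n x * p x) x (V x)
        = ψ n x * (p x * inner ℝ (score p x) (V x)) + p x * fderiv ℝ (ψ n) x (V x) := fun x => by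
      have := (((hψ n).differentiable (by simp) x).hasFDerivAt.mul
        (hpC.differentiable (by simp) x).hasFDerivAt).fderiv
      have h3 : fderiv ℝ (fun x => ψ n x * p x) x = _ := this
      rw [h3]
      simp [hfp]
    have hVc := hV.continuous
    have hψ' := (hψ n).continuous_fderiv (by simp)
    have hψ0 := (hψ n).continuous
    have hp' := hpC.continuous_fderiv (by simp)
    have hp0 := hpC.continuous
    have hdc := continuous_divergence hV
    have i1 : Integrable fun x => ψ n x * (p x * inner ℝ (score p x) (V x)) := by
      simp_rw [← hfp]
      exact Continuous.integrable_of_hasCompactSupport (by fun_prop) (hψc n).mul_right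
    have i2 : Integrable fun x => p x * fderiv ℝ (ψ n) x (V x) := by
      refine Continuous.integrable_of_hasCompactSupport (by fun_prop) ?_
      refine HasCompactSupport.mul_left ?_
      refine ((hψc n).fderiv ℝ).mono fun x hx => ?_
      contrapose! hx
      simp only [Function.mem_support, not_not] at hx ⊢
      simp [hx]
    have i3 : Integrable fun x => ψ n x * p x * divergence V x :=
      Continuous.integrable_of_hasCompactSupport (by fun_prop) (hψc n).mul_right.mul_right
    simp_rw [h2] at h1
    rw [integral_add i1 i2] at h1
    rw [p.integral_law, p.integral_law]
    have h4 : ∀ x, p x * (ψ n x * G x) =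
        ψ n x * p x * divergence V x + ψ n x * (p x * inner ℝ (score p x) (V x)) := fun x => by
      simp only [hG]; ring
    simp_rw [h4]
    rw [integral_add i3 i1, h1]
    ring
  have lim1 : Tendsto (fun n => ∫ x, ψ n x * G x ∂p.law) atTop (𝓝 (∫ x, G x ∂p.law)) := by
    refine tendsto_integral_of_dominated_convergence (fun x => |G x|)
      (fun n => (hψ n).continuous.aestronglyMeasurable.mul hGi.aestronglyMeasurable) hGi.abs
      (fun n => ae_of_all _ fun x => ?_) (ae_of_all _ fun x => ?_)
    · rw [Real.norm_eq_abs, abs_mul]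
      exact mul_le_of_le_one_left (abs_nonneg _) (hψ1 n x)
    · refine tendsto_const_nhds.congr' ?_
      filter_upwards [hψe x] with n hn
      simp [hn]
  have lim2 : Tendsto (fun n => ∫ x, ψ n x * G x ∂p.law) atTop (𝓝 0) := by
    refine squeeze_zero_norm (a := fun n : ℕ => C / ((n : ℝ) + 1) * ∫ x, H x ∂p.law)
      (fun n => ?_) ?_
    · rw [key, norm_neg, ← integral_const_mul]
      refine norm_integral_le_of_norm_le (hHi.const_mul _) (ae_of_all _ fun x => ?_)
      simpa only [hH, inner_score, Real.norm_eq_abs] using hψd n x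
    · have := (tendsto_const_div_atTop_nhds_zero_nat C).comp (tendsto_add_atTop_nat 1)
      simpa [Function.comp_def] using this.mul_const (∫ x, H x ∂p.law)
  exact tendsto_nhds_unique lim1 lim2

/-! ### The post-change mean of the detection score -/

section DetectionScore

variable {d w : ℕ} {m : E d → Matrix (Fin d) (Fin w) ℝ}

lemma mT_sub (x u v : E d) : mT m x (u - v) = mT m x u - mT m x v := by
  ext i
  simp [mT, Matrix.mulVec_sub]

lemma inner_mmT (x u v : E d) : inner ℝ u (mmT m x v) = inner ℝ (mT m x u) (mT m x v) := by
  simp only [EuclideanSpace.inner_eq_star_dotProduct, mmT, mT, star_trivial]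
  rw [← Matrix.mulVec_mulVec, dotProduct_comm, Matrix.dotProduct_mulVec, dotProduct_comm,
    Matrix.mulVec_transpose, Matrix.mulVec_transpose, dotProduct_comm]

lemma contDiff_mmT {s : E d → E d} (hm : ∀ i j, ContDiff ℝ 1 fun x => m x i j)
    (hs : ContDiff ℝ 1 s) : ContDiff ℝ 1 fun x => mmT m x (s x) := by
  rw [contDiff_euclidean]
  intro i
  simp only [mmT, Matrix.mulVec, dotProduct, Matrix.mul_apply, Matrix.transpose_apply]
  fun_prop

lemma continuous_mT {s : E d → E d} (hm : ∀ i j, Continuous fun x => m x i j)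
    (hs : Continuous s) : Continuous fun x => mT m x (s x) := by
  refine (PiLp.continuous_toLp 2 _).comp (continuous_pi fun i => ?_)
  simp only [Matrix.mulVec, dotProduct, Matrix.transpose_apply]
  fun_prop

lemma continuous_hyvScore {p : Density d} (hm : ∀ i j, ContDiff ℝ 1 fun x => m x i j)
    (hs : ContDiff ℝ 1 (score p)) : Continuous (hyvScore m p) := by
  have h1 := continuous_divergence (contDiff_mmT hm hs)
  have h2 := continuous_mT (fun i j => (hm i j).continuous) hs.continuous
  unfold hyvScore
  fun_prop

/-- A continuous vector field `V` such that `q V` vanishes at infinity is bounded wherever `q` is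
bounded away from zero. -/
lemma exists_norm_le_of_tendsto_smul (q : Density d) {V : E d → E d} (hV : Continuous V)
    (h : Tendsto (fun x => q x • V x) (cocompact (E d)) (𝓝 0)) (N : ℝ) :
    ∃ C, ∀ x, -N ≤ Real.log (q x) → ‖V x‖ ≤ C := by
  have hc : Continuous fun x => q x • V x := q.contDiff.continuous.smul hV
  have h1 : ∀ᶠ x in cocompact (E d), ‖q x • V x‖ < 1 := by
    simpa using h.norm.eventually_lt_const (by simp : ‖(0 : E d)‖ < 1)
  obtain ⟨K, hK, hKs⟩ := mem_cocompact.1 h1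
  obtain ⟨B, hB⟩ := hK.exists_bound_of_continuousOn hc.continuousOn
  -- The norm of qV is at most B on the compact set and below 1 off it; dividing by q ≥ exp(-N)
  -- gives the bound.
  refine ⟨max B 1 * Real.exp N, fun x hx => ?_⟩
  have h2 : ‖q x • V x‖ ≤ max B 1 := by
    by_cases hxK : x ∈ K
    · exact (hB x hxK).trans (le_max_left _ _)
    · exact (le_of_lt (hKs hxK)).trans (le_max_right _ _)
  rw [norm_smul, Real.norm_of_nonneg (q.pos x).le] at h2
  have h3 : Real.exp (-N) ≤ q x := by
    rwa [← Real.le_log_iff_exp_le (q.pos x)]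
  calc ‖V x‖ = Real.exp (-N) * ‖V x‖ * Real.exp N := by
        rw [mul_right_comm, ← Real.exp_add]; simp
    _ ≤ q x * ‖V x‖ * Real.exp N := by gcongr
    _ ≤ _ := by gcongr

lemma integrable_of_lintegral_ofReal_lt_top {α : Type*} [MeasurableSpace α] {μ : Measure α}
    {f : α → ℝ} (hf : AEStronglyMeasurable f μ) (h0 : ∀ x, 0 ≤ f x)
    (h : ∫⁻ x, ENNReal.ofReal (f x) ∂μ < ∞) : Integrable f μ :=
  ⟨hf, (hasFiniteIntegral_iff_ofReal (ae_of_all _ h0)).2 h⟩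

lemma integrable_of_lintegral_sq_lt_top {α : Type*} [MeasurableSpace α] {μ : Measure α}
    [IsFiniteMeasure μ] {f : α → ℝ} (hf : AEStronglyMeasurable f μ)
    (h : ∫⁻ x, ENNReal.ofReal (f x ^ 2) ∂μ < ∞) : Integrable f μ :=
  ((memLp_two_iff_integrable_sq hf).2 (integrable_of_lintegral_ofReal_lt_top (hf.pow 2)
    (fun _ => sq_nonneg _) h)).integrable one_le_two

lemma continuous_detScore {pInf p1 : Density d} (hreg : RegularPair m pInf p1)
    (hreg' : RegularPair m p1 pInf) : Continuous (detScore m pInf p1) :=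
  (continuous_hyvScore hreg.contDiff_m hreg'.contDiff_score).sub
    (continuous_hyvScore hreg.contDiff_m hreg.contDiff_score)

lemma integrable_detScore {pInf p1 : Density d} (hreg : RegularPair m pInf p1)
    (hreg' : RegularPair m p1 pInf)
    (hmom : ∫⁻ x, ENNReal.ofReal (hyvScore m pInf x ^ 2) ∂p1.law < ∞)
    (hmom' : ∫⁻ x, ENNReal.ofReal (hyvScore m p1 x ^ 2) ∂p1.law < ∞) :
    Integrable (detScore m pInf p1) p1.law :=
  (integrable_of_lintegral_sq_lt_top (continuous_hyvScore hreg.contDiff_m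
    hreg'.contDiff_score).aestronglyMeasurable hmom).sub
  (integrable_of_lintegral_sq_lt_top (continuous_hyvScore hreg.contDiff_m
    hreg.contDiff_score).aestronglyMeasurable hmom')

/-- The post-change mean of the detection score is the diffusion divergence. -/
lemma diffusionDivergence_eq_integral_detScore {pInf p1 : Density d}
    (hreg : RegularPair m pInf p1) (hreg' : RegularPair m p1 pInf)
    (hmom : ∫⁻ x, ENNReal.ofReal (hyvScore m pInf x ^ 2) ∂p1.law < ∞)
    (hmom' : ∫⁻ x, ENNReal.ofReal (hyvScore m p1 x ^ 2) ∂p1.law < ∞) :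
    diffusionDivergence m p1 pInf = ENNReal.ofReal (∫ x, detScore m pInf p1 x ∂p1.law) := by
  set a : E d → E w := fun x => mT m x (score pInf x) with ha
  set b : E d → E w := fun x => mT m x (score p1 x) with hb
  have hmc : ∀ i j, Continuous fun x => m x i j := fun i j => (hreg.contDiff_m i j).continuous
  have hac : Continuous a := continuous_mT hmc hreg'.contDiff_score.continuous
  have hbc : Continuous b := continuous_mT hmc hreg.contDiff_score.continuous
  have ha2 : Integrable (fun x => ‖a x‖ ^ 2) p1.law := integrable_of_lintegral_ofReal_lt_top
    (by fun_prop) (fun x => sq_nonneg _) hreg'.moment_s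
  have hb2 : Integrable (fun x => ‖b x‖ ^ 2) p1.law := integrable_of_lintegral_ofReal_lt_top
    (by fun_prop) (fun x => sq_nonneg _) hreg'.moment_r
  have hcross : ∀ u v : E d → E w, Continuous u → Continuous v →
      Integrable (fun x => ‖u x‖ ^ 2) p1.law → Integrable (fun x => ‖v x‖ ^ 2) p1.law →
      Integrable (fun x => inner ℝ (u x) (v x)) p1.law := fun u v hu hv hu2 hv2 => by
    refine (hu2.add hv2).mono' (hu.inner hv).aestronglyMeasurable (ae_of_all _ fun x => ?_)
    refine (norm_inner_le_norm _ _).trans ?_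
    simp only [Pi.add_apply]
    nlinarith [sq_nonneg (‖u x‖ - ‖v x‖), sq_nonneg (‖u x‖ + ‖v x‖)]
  have hV0 := contDiff_mmT hreg.contDiff_m hreg'.contDiff_score
  have hV1 := contDiff_mmT hreg.contDiff_m hreg.contDiff_score
  -- The divergence is the Hyvärinen score minus half the squared norm, both integrable.
  have hd0 : Integrable (divergence fun y => mmT m y (score pInf y)) p1.law := by
    have h := (integrable_of_lintegral_sq_lt_top (continuous_hyvScore hreg.contDiff_m
      hreg'.contDiff_score).aestronglyMeasurable hmom).sub (ha2.const_mul (1 / 2))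
    refine h.congr (ae_of_all _ fun x => ?_)
    simp [hyvScore, ha]
  have hd1 : Integrable (divergence fun y => mmT m y (score p1 y)) p1.law := by
    have h := (integrable_of_lintegral_sq_lt_top (continuous_hyvScore hreg.contDiff_m
      hreg.contDiff_score).aestronglyMeasurable hmom').sub (hb2.const_mul (1 / 2))
    refine h.congr (ae_of_all _ fun x => ?_)
    simp [hyvScore, hb]
  have s0 : ∫ x, (divergence (fun y => mmT m y (score pInf y)) x
      + inner ℝ (score p1 x) (mmT m x (score pInf x))) ∂p1.law = 0 := by
    refine integral_stein_eq_zero p1 pInf hV0 ?_ ?_ hd0 fun N => ?_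
    · simpa only [inner_mmT] using hcross b a hbc hac hb2 ha2
    · simpa only [inner_mmT] using hcross a a hac hac ha2 ha2
    · obtain ⟨C, hC⟩ := exists_norm_le_of_tendsto_smul p1 hV0.continuous hreg.vanish N
      exact ⟨C, fun x h _ => hC x h⟩
  have s1 : ∫ x, (divergence (fun y => mmT m y (score p1 y)) x
      + inner ℝ (score p1 x) (mmT m x (score p1 x))) ∂p1.law = 0 := by
    -- The available decay is that of `pInf` times this field, although the mean is under `p1`.
    -- Hence the field is bounded only where `pInf` is bounded below, which is why the Stein
    -- identity carries a second density.
    refine integral_stein_eq_zero p1 pInf hV1 ?_ ?_ hd1 fun N => ?_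
    · simpa only [inner_mmT] using hcross b b hbc hbc hb2 hb2
    · simpa only [inner_mmT] using hcross a b hac hbc ha2 hb2
    · obtain ⟨C, hC⟩ := exists_norm_le_of_tendsto_smul pInf hV1.continuous hreg'.vanish N
      exact ⟨C, fun x _ h => hC x h⟩
  simp only [inner_mmT] at s0 s1
  have hab : Integrable (fun x => 1 / 2 * ‖b x - a x‖ ^ 2) p1.law := by
    refine Integrable.congr (((ha2.add hb2).sub
      ((hcross a b hac hbc ha2 hb2).const_mul 2)).const_mul (1 / 2)) (ae_of_all _ fun x => ?_)
    simp only [Pi.add_apply, Pi.sub_apply]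
    rw [norm_sub_sq_real, real_inner_comm]
    ring
  have i0 : Integrable (fun x => divergence (fun y => mmT m y (score pInf y)) x
      + inner ℝ (b x) (a x)) p1.law := hd0.add (hcross b a hbc hac hb2 ha2)
  have i1 : Integrable (fun x => divergence (fun y => mmT m y (score p1 y)) x
      + inner ℝ (b x) (b x)) p1.law := hd1.add (hcross b b hbc hbc hb2 hb2)
  have i01 : Integrable (fun x => (divergence (fun y => mmT m y (score pInf y)) x
      + inner ℝ (b x) (a x)) - (divergence (fun y => mmT m y (score p1 y)) x
      + inner ℝ (b x) (b x))) p1.law := i0.sub i1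
  -- Completing the square writes Z as the integrand of the divergence plus a difference of two
  -- Stein terms, each of mean zero.
  have hZ : ∀ x, detScore m pInf p1 x = 1 / 2 * ‖b x - a x‖ ^ 2
      + ((divergence (fun y => mmT m y (score pInf y)) x + inner ℝ (b x) (a x))
      - (divergence (fun y => mmT m y (score p1 y)) x + inner ℝ (b x) (b x))) := fun x => by
    rw [norm_sub_sq_real, real_inner_self_eq_norm_sq]
    simp only [detScore, hyvScore, ha, hb]
    ring
  have hint : ∫ x, detScore m pInf p1 x ∂p1.law = ∫ x, 1 / 2 * ‖b x - a x‖ ^ 2 ∂p1.law := by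
    simp_rw [hZ]
    rw [integral_add hab i01, integral_sub i0 i1, s0, s1]
    simp
  rw [hint, ofReal_integral_eq_lintegral_ofReal hab (ae_of_all _ fun x => by positivity)]
  simp only [diffusionDivergence, mT_sub, hb, ha]

end DetectionScore

/-! ### The stopping rule and its survival events -/

section RunLength

open ProbabilityTheory

variable {d : ℕ} {Z : E d → ℝ} {c : ℝ} {X : Stream d}

lemma cusum_nonneg (Z : E d → ℝ) (X : Stream d) : ∀ t, 0 ≤ cusum Z X t
  | 0 => le_rfl
  | _ + 1 => le_max_left _ _

lemma stoppingRule_le {t : ℕ} (h : c ≤ cusum Z X t) : stoppingRule Z c X ≤ t :=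
  iInf₂_le t h

lemma lt_stoppingRule_iff {n : ℕ} :
    (n : ℕ∞) < stoppingRule Z c X ↔ ∀ t ≤ n, cusum Z X t < c := by
  constructor
  · intro h t ht
    by_contra! hc
    exact absurd (h.trans_le (stoppingRule_le hc)) (by simpa using ht)
  · intro h
    have : ((n + 1 : ℕ) : ℕ∞) ≤ stoppingRule Z c X := by
      refine le_iInf₂ fun t ht => ?_
      by_contra! hlt
      have : t ≤ n := by
        have : t < n + 1 := by exact_mod_cast hlt
        omega
      exact absurd (h t this) (not_lt.2 ht)
    exact lt_of_lt_of_le (by exact_mod_cast n.lt_succ_self) this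

/-- The set of streams for which the threshold `c` is not reached up to time `n`. -/
def survival (Z : E d → ℝ) (c : ℝ) (n : ℕ) : Set (Stream d) := {X | ∀ t ≤ n, cusum Z X t < c}

lemma tsum_indicator_lt (τ : ℕ∞) [∀ n : ℕ, Decidable ((n : ℕ∞) < τ)] :
    ∑' n : ℕ, (if (n : ℕ∞) < τ then (1 : ℝ≥0∞) else 0) = τ := by
  rcases eq_or_ne τ ⊤ with rfl | h
  · simp
  · obtain ⟨k, rfl⟩ := ENat.ne_top_iff_exists.1 h
    rw [tsum_eq_sum (s := Finset.range k) (by simp)]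
    have : ∀ n ∈ Finset.range k, (if (n : ℕ∞) < (k : ℕ∞) then (1 : ℝ≥0∞) else 0) = 1 := by
      intro n hn
      simpa using hn
    rw [Finset.sum_congr rfl this]
    simp

/-- Tail-sum formula: it turns E[τ] into the sum of the probabilities P(τ > n), with no finiteness
assumed. -/
lemma toENNReal_stoppingRule :
    (stoppingRule Z c X : ℝ≥0∞) = ∑' n, (survival Z c n).indicator 1 X := by
  classical
  rw [← tsum_indicator_lt]
  refine tsum_congr fun n => ?_
  simp only [Set.indicator_apply, survival, Set.mem_ofPred_eq, lt_stoppingRule_iff, Pi.one_apply]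

/-! ### Independence of past and future; reduction to the mean run length -/

lemma past_le (ν : ℕ+) : past d ν ≤ MeasurableSpace.pi :=
  iSup₂_le fun i _ => (measurable_pi_apply i).comap_le

/-- The σ-algebra generated by the observations `X_i`, `i ≥ ν`. -/
abbrev future (d : ℕ) (ν : ℕ+) : MeasurableSpace (Stream d) :=
  ⨆ (i : ℕ+) (_ : ν ≤ i), MeasurableSpace.comap (fun X : Stream d => X i) inferInstance

lemma future_le (ν : ℕ+) : future d ν ≤ MeasurableSpace.pi :=
  iSup₂_le fun i _ => (measurable_pi_apply i).comap_le

lemma measurable_past_apply {i ν : ℕ+} (h : i < ν) :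
    Measurable[past d ν] (fun X : Stream d => X i) :=
  (comap_measurable _).mono (le_iSup₂ (f := fun (i : ℕ+) (_ : i < ν) =>
    MeasurableSpace.comap (fun X : Stream d => X i) inferInstance) i h) le_rfl

lemma measurable_future_apply {i ν : ℕ+} (h : ν ≤ i) :
    Measurable[future d ν] (fun X : Stream d => X i) :=
  (comap_measurable _).mono (le_iSup₂ (f := fun (i : ℕ+) (_ : ν ≤ i) =>
    MeasurableSpace.comap (fun X : Stream d => X i) inferInstance) i h) le_rfl

lemma indep_past_future (μ : ℕ+ → Measure (E d)) [∀ i, IsProbabilityMeasure (μ i)] (ν : ℕ+) :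
    Indep (past d ν) (future d ν) (Measure.infinitePi μ) := by
  have h : iIndepFun (fun (i : ℕ+) (X : Stream d) => X i) (Measure.infinitePi μ) :=
    iIndepFun_infinitePi (X := fun _ x => x) fun _ => measurable_id
  exact indep_iSup_of_disjoint (S := Set.Iio ν) (T := Set.Ici ν)
    (fun i => (measurable_pi_apply i).comap_le) h.iIndep (Set.Iio_disjoint_Ici le_rfl)

lemma measurable_cusum_past (hZ : Measurable Z) (ν : ℕ+) :
    ∀ t : ℕ, t < (ν : ℕ) → Measurable[past d ν] fun X => cusum Z X t
  | 0, _ => measurable_const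
  | t + 1, h => by
    have h1 := measurable_cusum_past hZ ν t (by omega)
    have h2 : Measurable[past d ν] fun X : Stream d => Z (X t.succPNat) :=
      hZ.comp (measurable_past_apply (by rwa [← PNat.coe_lt_coe, Nat.succPNat_coe]))
    exact Measurable.max measurable_const (h1.add h2)

/-- Survival up to time n involves only the first n observations, hence is independent of
observation n + 1. This is the predictability that Wald's identity needs. -/
lemma measurableSet_survival_past (hZ : Measurable Z) (n : ℕ) :
    MeasurableSet[past d n.succPNat] (survival Z c n) := by
  have : survival Z c n = ⋂ t ∈ Set.Iic n, {X | cusum Z X t < c} := by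
    ext X; simp [survival]
  rw [this]
  refine MeasurableSet.biInter (Set.to_countable _) fun t ht => ?_
  have ht' : t < (n.succPNat : ℕ) := by simpa [Nat.lt_succ_iff] using ht
  exact measurableSet_lt (measurable_cusum_past hZ _ t ht') measurable_const

lemma measurableSet_survival (hZ : Measurable Z) (n : ℕ) : MeasurableSet (survival Z c n) :=
  past_le _ _ (measurableSet_survival_past hZ n)

lemma measurable_stoppingRule (hZ : Measurable Z) (c : ℝ) :
    Measurable fun X => (stoppingRule Z c X : ℝ≥0∞) := by
  simp_rw [toENNReal_stoppingRule]
  exact Measurable.tsum fun n =>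
    measurable_one.indicator (measurableSet_survival hZ n)

/-- The stream of the observations from time `ν` on. -/
def shift (ν : ℕ+) (X : Stream d) : Stream d := fun i => X (i.natPred + ν.natPred).succPNat

lemma measurable_shift_future (ν : ℕ+) : Measurable[future d ν] (shift (d := d) ν) := by
  refine @measurable_pi_lambda _ _ _ (future d ν) _ _ fun i => measurable_future_apply ?_
  rw [← PNat.coe_le_coe, Nat.succPNat_coe, ← PNat.natPred_add_one ν]
  omega

/-- At time ν - 1 the original statistic is nonnegative while the restarted one is zero, and the
recursion preserves the order. -/
lemma cusum_shift_le (ν : ℕ+) :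
    ∀ t, cusum Z (shift ν X) t ≤ cusum Z X (t + ν.natPred)
  | 0 => cusum_nonneg _ _ _
  | t + 1 => by
    have h := cusum_shift_le ν t
    have e : t + 1 + ν.natPred = t + ν.natPred + 1 := by omega
    rw [e]
    simp only [cusum, shift, Nat.natPred_succPNat]
    exact max_le_max le_rfl (add_le_add h le_rfl)

lemma delay_stoppingRule_le (ν : ℕ+) :
    delay (stoppingRule Z c X) ν ≤ (stoppingRule Z c (shift ν X) : ℝ≥0∞) := by
  refine ENat.toENNReal_le.2 ?_
  rw [tsub_le_iff_right]
  rcases eq_or_ne (stoppingRule Z c (shift ν X)) ⊤ with h | h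
  · simp [h]
  · obtain ⟨n, hn⟩ := ENat.ne_top_iff_exists.1 h
    have h1 : ¬ (n : ℕ∞) < stoppingRule Z c (shift ν X) := by simp [← hn]
    rw [lt_stoppingRule_iff] at h1
    push Not at h1
    obtain ⟨t, ht, hc⟩ := h1
    have h2 := stoppingRule_le (hc.trans (cusum_shift_le (X := X) ν t))
    rw [← hn, ← PNat.natPred_add_one ν]
    calc stoppingRule Z c X + 1 ≤ ((t + ν.natPred : ℕ) : ℕ∞) + 1 := by gcongr
      _ ≤ _ := by
        norm_cast
        omega

lemma streamLaw_one (P Q : Measure (E d)) [IsProbabilityMeasure P] [IsProbabilityMeasure Q] :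
    streamLaw P Q 1 = Measure.infinitePi fun _ => Q := by
  simp [streamLaw]

instance (P Q : Measure (E d)) [IsProbabilityMeasure P] [IsProbabilityMeasure Q] (ν : ℕ+) :
    IsProbabilityMeasure (streamLaw P Q ν) := by
  unfold streamLaw; infer_instance

lemma map_shift_streamLaw (P Q : Measure (E d)) [IsProbabilityMeasure P]
    [IsProbabilityMeasure Q] (ν : ℕ+) :
    (streamLaw P Q ν).map (shift ν) = Measure.infinitePi fun _ => Q := by
  have hinj : Function.Injective fun i : ℕ+ => (i.natPred + ν.natPred).succPNat := by
    intro i j h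
    have h1 := Nat.succPNat_injective h
    exact PNat.natPred_injective (by omega)
  have hlt : ∀ i : ℕ+, ¬ (i.natPred + ν.natPred).succPNat < ν := fun i => by
    rw [not_lt, ← PNat.coe_le_coe, Nat.succPNat_coe, ← PNat.natPred_add_one ν]
    omega
  have h := Measure.map_infinitePi_infinitePi_of_inj
    (P := fun i : ℕ+ => if i < ν then P else Q) hinj
  refine h.trans ?_
  simp [hlt]

lemma condLExp_of_indep {Ω : Type*} {m₁ m₂ mΩ : MeasurableSpace Ω} {μ : Measure Ω}
    [IsProbabilityMeasure μ] (h₁ : m₁ ≤ mΩ) (h₂ : m₂ ≤ mΩ) (hind : Indep m₁ m₂ μ)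
    {f : Ω → ℝ≥0∞} (hf : Measurable[m₂] f) :
    condLExp m₁ μ f =ᵐ[μ] fun _ => ∫⁻ ω, f ω ∂μ := by
  refine (ae_eq_condLExp h₁ μ f measurable_const fun s hs => ?_).symm
  have h := lintegral_mul_eq_lintegral_mul_lintegral_of_independent_measurableSpace h₁ h₂ hind
    ((measurable_const (a := (1 : ℝ≥0∞))).indicator hs) hf
  rw [setLIntegral_const, ← lintegral_indicator (h₁ s hs)]
  rw [lintegral_indicator_const (h₁ s hs), one_mul, mul_comm] at h
  rw [← h]
  refine lintegral_congr fun ω => ?_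
  by_cases hω : ω ∈ s <;> simp [hω]

/-- The worst case delay of the CUSUM rule is its mean run length under the post-change law. -/
lemma wadd_stoppingRule (P Q : Measure (E d)) [IsProbabilityMeasure P] [IsProbabilityMeasure Q]
    (hZ : Measurable Z) (c : ℝ) :
    wadd P Q (stoppingRule Z c) =
      ∫⁻ X, (stoppingRule Z c X : ℝ≥0∞) ∂Measure.infinitePi fun _ : ℕ+ => Q := by
  refine le_antisymm (iSup_le fun ν => ?_) ?_
  · refine essSup_le_of_ae_le _ ?_
    have hsh : Measurable (shift (d := d) ν) :=
      (measurable_shift_future ν).mono (future_le ν) le_rfl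
    have h1 := condLExp_mono (mΩ := past d ν) (P := streamLaw P Q ν)
      (ae_of_all _ fun X => delay_stoppingRule_le (Z := Z) (c := c) (X := X) ν)
    have h2 := condLExp_of_indep (past_le ν) (future_le ν)
      (indep_past_future (fun i : ℕ+ => if i < ν then P else Q) ν)
      ((measurable_stoppingRule hZ c).comp (measurable_shift_future ν))
    have h3 : ∫⁻ X, (stoppingRule Z c (shift ν X) : ℝ≥0∞) ∂streamLaw P Q ν
        = ∫⁻ X, (stoppingRule Z c X : ℝ≥0∞) ∂Measure.infinitePi fun _ : ℕ+ => Q := by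
      rw [← map_shift_streamLaw P Q ν, lintegral_map (measurable_stoppingRule hZ c) hsh]
    refine h1.trans (h2.le.trans (ae_of_all _ fun X => ?_))
    exact h3.le
  -- At ν = 1 the past is trivial, so conditioning does nothing, and the delay is τ itself.
  · refine le_trans ?_ (le_iSup _ (1 : ℕ+))
    have hbot : past d 1 = ⊥ := by simp [past]
    rw [hbot, condLExp_bot, essSup_const _ (IsProbabilityMeasure.ne_zero _), streamLaw_one]
    refine lintegral_mono fun X => ?_
    refine ENat.toENNReal_le.2 ?_
    rw [PNat.one_coe, Nat.cast_one]
    exact (ENat.addLECancellable_of_ne_top ENat.one_ne_top).add_tsub_cancel_right.ge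

/-! ### Upper bound by truncated Wald -/

/-- Pathwise bound on the stopped sum of the truncated increments. -/
lemma sum_indicator_survival_le {M : ℝ} (hc : 0 < c) (hM : 0 ≤ M) (n : ℕ) :
    ∑ i ∈ Finset.range n, (survival Z c i).indicator (1 : Stream d → ℝ) X
      * min (Z (X i.succPNat)) M ≤ c + M := by
  -- Until the crossing the truncated sum is dominated by the statistic, hence below c; the crossing
  -- step adds at most M; afterwards the sum is frozen.
  suffices h : (X ∈ survival Z c n ∧
      ∑ i ∈ Finset.range n, (survival Z c i).indicator (1 : Stream d → ℝ) X
        * min (Z (X i.succPNat)) M ≤ cusum Z X n) ∨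
      (X ∉ survival Z c n ∧
      ∑ i ∈ Finset.range n, (survival Z c i).indicator (1 : Stream d → ℝ) X
        * min (Z (X i.succPNat)) M ≤ c + M) by
    rcases h with ⟨h1, h2⟩ | ⟨_, h2⟩
    · have := h1 n le_rfl
      linarith
    · exact h2
  induction n with
  | zero =>
    refine Or.inl ⟨fun t ht => ?_, by simp [cusum]⟩
    obtain rfl : t = 0 := by omega
    exact hc
  | succ n ih =>
    rw [Finset.sum_range_succ]
    rcases ih with ⟨h1, h2⟩ | ⟨h1, h2⟩
    · rw [Set.indicator_of_mem h1, Pi.one_apply, one_mul]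
      by_cases h : X ∈ survival Z c (n + 1)
      · refine Or.inl ⟨h, ?_⟩
        exact (add_le_add h2 (min_le_left _ _)).trans (le_max_right _ _)
      · refine Or.inr ⟨h, add_le_add (h2.trans (h1 n le_rfl).le) (min_le_right _ _)⟩
    · rw [Set.indicator_of_notMem h1, zero_mul, add_zero]
      exact Or.inr ⟨fun h => h1 fun t ht => h t (by omega), h2⟩

/-- Truncation costs arbitrarily little drift: for large M the truncated mean is positive and close
to the true one. -/
lemma tendsto_integral_min (Q : Measure (E d)) (hZ : Measurable Z) (hZi : Integrable Z Q) :
    Tendsto (fun M : ℕ => ∫ x, min (Z x) M ∂Q) atTop (𝓝 (∫ x, Z x ∂Q)) := by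
  refine tendsto_integral_of_dominated_convergence (fun x => |Z x|)
    (fun M => (hZ.min measurable_const).aestronglyMeasurable) hZi.abs
    (fun M => ae_of_all _ fun x => ?_) (ae_of_all _ fun x => ?_)
  · have hM : (0 : ℝ) ≤ M := Nat.cast_nonneg M
    rcases min_cases (Z x) (M : ℝ) with ⟨h, _⟩ | ⟨h, h'⟩
    · rw [h, Real.norm_eq_abs]
    · rw [h, Real.norm_of_nonneg hM]
      exact h'.le.trans (le_abs_self _)
  · refine tendsto_const_nhds.congr' ?_
    filter_upwards [eventually_ge_atTop ⌈Z x⌉₊] with M hM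
    rw [min_eq_left ((Nat.le_ceil _).trans (by exact_mod_cast hM))]

variable (Q : Measure (E d)) [IsProbabilityMeasure Q]

lemma map_eval_infinitePi (i : ℕ+) :
    (Measure.infinitePi fun _ : ℕ+ => Q).map (fun X => X i) = Q :=
  Measure.infinitePi_map_eval (fun _ : ℕ+ => Q) i

lemma integral_eval_infinitePi (i : ℕ+) {f : E d → ℝ} (hf : Measurable f) :
    ∫ X, f (X i) ∂(Measure.infinitePi fun _ : ℕ+ => Q) = ∫ x, f x ∂Q := by
  conv_rhs => rw [← map_eval_infinitePi Q i]
  rw [integral_map (measurable_pi_apply i).aemeasurable hf.aestronglyMeasurable]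

lemma integrable_eval_infinitePi (i : ℕ+) {f : E d → ℝ} (hf : Integrable f Q) :
    Integrable (fun X => f (X i)) (Measure.infinitePi fun _ : ℕ+ => Q) := by
  have h : Integrable f ((Measure.infinitePi fun _ : ℕ+ => Q).map (fun X => X i)) := by
    rwa [map_eval_infinitePi]
  exact h.comp_measurable (measurable_pi_apply i)

/-- Wald's identity for the truncated increments bounds the mean run length. -/
lemma lintegral_stoppingRule_le (hZ : Measurable Z) (hZi : Integrable Z Q) {M : ℝ} (hc : 0 < c)
    (hM : 0 ≤ M) (hpos : 0 < ∫ x, min (Z x) M ∂Q) :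
    ∫⁻ X, (stoppingRule Z c X : ℝ≥0∞) ∂(Measure.infinitePi fun _ : ℕ+ => Q) ≤
      ENNReal.ofReal ((c + M) / ∫ x, min (Z x) M ∂Q) := by
  set μ := Measure.infinitePi fun _ : ℕ+ => Q
  set D := ∫ x, min (Z x) M ∂Q
  have hWm : Measurable fun x => min (Z x) M := hZ.min measurable_const
  have hWi : Integrable (fun x => min (Z x) M) Q := hZi.inf (integrable_const M)
  simp_rw [toENNReal_stoppingRule]
  rw [lintegral_tsum fun n => (measurable_one.indicator
    (measurableSet_survival hZ n)).aemeasurable]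
  simp_rw [lintegral_indicator_one (measurableSet_survival hZ _)]
  -- Bounding finite partial sums uniformly applies Wald's argument without knowing beforehand that
  -- E[τ] is finite.
  refine ENNReal.tsum_le_of_sum_range_le fun n => ?_
  have hterm : ∀ i, ∫ X, (survival Z c i).indicator (1 : Stream d → ℝ) X
      * min (Z (X i.succPNat)) M ∂μ = μ.real (survival Z c i) * D := fun i => by
    have hind : IndepFun ((survival Z c i).indicator (1 : Stream d → ℝ))
        (fun X => min (Z (X i.succPNat)) M) μ := by
      refine indep_of_indep_of_le_left (indep_of_indep_of_le_right
        (indep_past_future (fun _ : ℕ+ => Q) i.succPNat) ?_) ?_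
      · exact (hWm.comp (measurable_future_apply le_rfl)).comap_le
      · have h1 : Measurable[past d i.succPNat] ((survival Z c i).indicator (1 : Stream d → ℝ)) :=
          @Measurable.indicator _ _ _ _ (past d i.succPNat) _ _
            (@measurable_one _ _ _ (past d i.succPNat) _) (measurableSet_survival_past hZ i)
        exact h1.comap_le
    have h := hind.integral_mul_eq_mul_integral
      (measurable_one.indicator (measurableSet_survival hZ i)).aestronglyMeasurable
      (hWm.comp (measurable_pi_apply i.succPNat)).aestronglyMeasurable
    rw [integral_indicator_one (measurableSet_survival hZ i),
      integral_eval_infinitePi Q i.succPNat hWm] at h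
    exact h
  have hti : ∀ i, Integrable (fun X => (survival Z c i).indicator (1 : Stream d → ℝ) X
      * min (Z (X i.succPNat)) M) μ := fun i => by
    refine (integrable_eval_infinitePi Q i.succPNat hWi).bdd_mul (c := 1)
      (measurable_one.indicator (measurableSet_survival hZ i)).aestronglyMeasurable
      (ae_of_all _ fun X => ?_)
    by_cases h : X ∈ survival Z c i <;> simp [h]
  have hsum : (∑ i ∈ Finset.range n, μ.real (survival Z c i)) * D ≤ c + M := by
    rw [Finset.sum_mul]
    simp_rw [← hterm]
    rw [← integral_finsetSum _ fun i _ => hti i]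
    calc _ ≤ ∫ _, (c + M) ∂μ := integral_mono (integrable_finsetSum _ fun i _ => hti i)
          (integrable_const _) fun X => sum_indicator_survival_le hc hM n
      _ = c + M := by simp
  rw [← ENNReal.ofReal_toReal (a := ∑ i ∈ Finset.range n, μ (survival Z c i))
    (by simp [ENNReal.sum_eq_top])]
  refine ENNReal.ofReal_le_ofReal ?_
  rw [ENNReal.toReal_sum (by simp), le_div_iff₀ hpos]
  exact hsum

/-! ### Lower bound by the strong law -/

/-- The index k is the last time the maximum reset the statistic to zero, or 0; from then on it
moves as the plain random walk. -/
lemma exists_cusum_eq_sub (Z : E d → ℝ) (X : Stream d) (n : ℕ) :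
    ∃ k ≤ n, cusum Z X n = ∑ i ∈ Finset.range n, Z (X i.succPNat)
      - ∑ i ∈ Finset.range k, Z (X i.succPNat) := by
  induction n with
  | zero => exact ⟨0, le_rfl, by simp [cusum]⟩
  | succ n ih =>
    obtain ⟨k, hk, h⟩ := ih
    rcases max_choice 0 (cusum Z X n + Z (X n.succPNat)) with h0 | h0
    · exact ⟨n + 1, le_rfl, by rw [sub_self]; exact h0⟩
    · refine ⟨k, hk.trans n.le_succ, h0.trans ?_⟩
      rw [h, Finset.sum_range_succ]
      ring

/-- The streams whose partial sums stay within `K + ε n` of the line of slope `D`. -/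
def nearLine (Z : E d → ℝ) (D ε K : ℝ) : Set (Stream d) :=
  {X | ∀ n : ℕ, |∑ i ∈ Finset.range n, Z (X i.succPNat) - n * D| ≤ K + ε * n}

lemma cusum_le_of_mem_nearLine {D ε K : ℝ} (hD : 0 ≤ D) (hε : 0 ≤ ε)
    (hX : X ∈ nearLine Z D ε K) (n : ℕ) : cusum Z X n ≤ n * (D + 2 * ε) + 2 * K := by
  obtain ⟨k, hk, h⟩ := exists_cusum_eq_sub Z X n
  -- With S the walk, S n - S k is at most (n - k)D + 2K + ε(n + k); then k ≤ n and D ≥ 0 are used.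
  have h1 := (abs_le.1 (hX n)).2
  have h2 := (abs_le.1 (hX k)).1
  have hk' : (k : ℝ) ≤ n := by exact_mod_cast hk
  have h3 : ε * k ≤ ε * n := mul_le_mul_of_nonneg_left hk' hε
  have h4 : 0 ≤ (k : ℝ) * D := by positivity
  rw [h]
  linarith

lemma le_stoppingRule_of_mem_nearLine {D ε K : ℝ} (hD : 0 < D) (hε : 0 ≤ ε)
    (hX : X ∈ nearLine Z D ε K) :
    ENNReal.ofReal ((c - 2 * K) / (D + 2 * ε)) ≤ (stoppingRule Z c X : ℝ≥0∞) := by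
  rcases eq_or_ne (stoppingRule Z c X) ⊤ with h | h
  · simp [h]
  · obtain ⟨n, hn⟩ := ENat.ne_top_iff_exists.1 h
    have h1 : ¬ (n : ℕ∞) < stoppingRule Z c X := by simp [← hn]
    rw [lt_stoppingRule_iff] at h1
    push Not at h1
    obtain ⟨t, ht, hc⟩ := h1
    have h2 := hc.trans (cusum_le_of_mem_nearLine hD.le hε hX t)
    rw [← hn, ENat.toENNReal_coe, ← ENNReal.ofReal_natCast]
    refine ENNReal.ofReal_le_ofReal ?_
    have ht' : (t : ℝ) ≤ n := by exact_mod_cast ht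
    refine le_trans ?_ ht'
    rw [div_le_iff₀ (by positivity)]
    linarith

lemma measurableSet_nearLine (hZ : Measurable Z) (D ε K : ℝ) :
    MeasurableSet (nearLine Z D ε K) := by
  have : nearLine Z D ε K = ⋂ n : ℕ, {X : Stream d |
      |∑ i ∈ Finset.range n, Z (X i.succPNat) - n * D| ≤ K + ε * n} := by
    ext X; simp [nearLine]
  rw [this]
  exact MeasurableSet.iInter fun n => measurableSet_le (by fun_prop) measurable_const

lemma ae_exists_mem_nearLine (hZ : Measurable Z) (hZi : Integrable Z Q) {ε : ℝ} (hε : 0 < ε) :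
    ∀ᵐ X ∂(Measure.infinitePi fun _ : ℕ+ => Q),
      ∃ K : ℕ, X ∈ nearLine Z (∫ x, Z x ∂Q) ε K := by
  set D := ∫ x, Z x ∂Q
  have hiid : iIndepFun (fun (i : ℕ+) (X : Stream d) => Z (X i))
      (Measure.infinitePi fun _ : ℕ+ => Q) := iIndepFun_infinitePi (X := fun _ => Z) fun _ => hZ
  have hslln := strong_law_ae_real (μ := Measure.infinitePi fun _ : ℕ+ => Q)
    (fun (n : ℕ) (X : Stream d) => Z (X n.succPNat))
    (integrable_eval_infinitePi Q _ hZi)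
    (fun i j hij => hiid.indepFun (Nat.succPNat_injective.ne hij))
    (fun i => by
      refine IdentDistrib.comp (u := Z) ⟨(measurable_pi_apply _).aemeasurable,
        (measurable_pi_apply _).aemeasurable, ?_⟩ hZ
      rw [map_eval_infinitePi, map_eval_infinitePi])
  rw [integral_eval_infinitePi Q _ hZ] at hslln
  filter_upwards [hslln] with X hX
  obtain ⟨N, hN⟩ := Metric.tendsto_atTop.1 hX ε hε
  -- The strong law handles n > N with error εn; K absorbs the finitely many earlier deviations at
  -- once.
  obtain ⟨K, hK⟩ := exists_nat_ge (∑ n ∈ Finset.range (N + 1),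
    |∑ i ∈ Finset.range n, Z (X i.succPNat) - n * D|)
  refine ⟨K, fun n => ?_⟩
  rcases lt_or_ge n (N + 1) with hn | hn
  · have h1 := Finset.single_le_sum
      (f := fun n : ℕ => |∑ i ∈ Finset.range n, Z (X i.succPNat) - n * D|)
      (fun _ _ => abs_nonneg _) (Finset.mem_range.2 hn)
    have : 0 ≤ ε * n := by positivity
    exact (h1.trans hK).trans (by linarith)
  · have h1 := hN n (by omega)
    have hn0 : (0 : ℝ) < n := by exact_mod_cast (by omega : 0 < n)
    rw [Real.dist_eq, div_sub' hn0.ne', abs_div, abs_of_pos hn0, div_lt_iff₀ hn0] at h1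
    have : (0 : ℝ) ≤ K := Nat.cast_nonneg K
    linarith

/-- Lower bound on the mean run length from the strong law of large numbers. -/
lemma exists_le_lintegral_stoppingRule (hZ : Measurable Z) (hZi : Integrable Z Q)
    (hD : 0 < ∫ x, Z x ∂Q) {ε : ℝ} (hε : 0 < ε) (hε1 : ε ≤ 1) :
    ∃ K : ℕ, ∀ c : ℝ, ENNReal.ofReal ((1 - ε) * ((c - 2 * K) / ((∫ x, Z x ∂Q) + 2 * ε))) ≤
      ∫⁻ X, (stoppingRule Z c X : ℝ≥0∞) ∂(Measure.infinitePi fun _ : ℕ+ => Q) := by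
  set D := ∫ x, Z x ∂Q
  set μ := Measure.infinitePi fun _ : ℕ+ => Q
  have hmono : Monotone fun K : ℕ => nearLine Z D ε K := fun K L h X hX n => by
    have : (K : ℝ) ≤ L := by exact_mod_cast h
    exact (hX n).trans (by linarith)
  have hone : μ (⋃ K : ℕ, nearLine Z D ε K) = 1 := by
    rw [← prob_compl_eq_zero_iff (MeasurableSet.iUnion fun K => measurableSet_nearLine hZ _ _ _)]
    have := ae_exists_mem_nearLine Q hZ hZi hε
    rw [ae_iff] at this
    simpa [Set.compl_def] using this
  have hlim := tendsto_measure_iUnion_atTop (μ := μ) hmono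
  rw [hone] at hlim
  -- The events increase with K to a set of full measure, so some K gives probability above 1 - ε.
  -- It does not depend on c.
  obtain ⟨K, hK⟩ := (hlim.eventually_const_lt
    (by simpa using hε : ENNReal.ofReal (1 - ε) < 1)).exists
  refine ⟨K, fun c => ?_⟩
  rw [ENNReal.ofReal_mul (by linarith)]
  calc _ ≤ μ (nearLine Z D ε K) * ENNReal.ofReal ((c - 2 * K) / (D + 2 * ε)) := by
        gcongr
        exact hK.le
    _ = ∫⁻ _ in nearLine Z D ε K, ENNReal.ofReal ((c - 2 * K) / (D + 2 * ε)) ∂μ := by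
        rw [setLIntegral_const, mul_comm]
    _ ≤ ∫⁻ X in nearLine Z D ε K, (stoppingRule Z c X : ℝ≥0∞) ∂μ :=
        setLIntegral_mono (measurable_stoppingRule hZ c) fun X hX =>
          le_stoppingRule_of_mem_nearLine hD hε.le hX
    _ ≤ _ := setLIntegral_le_lintegral _ _

/-! ### First-order asymptotics -/

lemma tendsto_affine_div (a b : ℝ) {k : ℝ} :
    Tendsto (fun c : ℝ => k * (c + a) * b / c) atTop (𝓝 (k * b)) := by
  have h : Tendsto (fun c : ℝ => k * b + k * b * a * c⁻¹) atTop (𝓝 (k * b + k * b * a * 0)) :=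
    tendsto_const_nhds.add (tendsto_inv_atTop_zero.const_mul _)
  rw [mul_zero, add_zero] at h
  refine h.congr' ?_
  filter_upwards [eventually_gt_atTop 0] with c hc
  field_simp

/-- First-order asymptotics of the mean run length of the CUSUM rule when the increments have
positive mean. -/
lemma tendsto_lintegral_stoppingRule (hZ : Measurable Z) (hZi : Integrable Z Q)
    (hD : 0 < ∫ x, Z x ∂Q) :
    Tendsto (fun c : ℝ => (∫⁻ X, (stoppingRule Z c X : ℝ≥0∞)
        ∂(Measure.infinitePi fun _ : ℕ+ => Q)) / (ENNReal.ofReal c / ENNReal.ofReal (∫ x, Z x ∂Q)))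
      atTop (𝓝 1) := by
  set D := ∫ x, Z x ∂Q with hDdef
  set e : ℝ → ℝ≥0∞ := fun c => ∫⁻ X, (stoppingRule Z c X : ℝ≥0∞)
        ∂(Measure.infinitePi fun _ : ℕ+ => Q) with he
  have hM := tendsto_integral_min Q hZ hZi
  have hfin : ∀ c, 0 < c → e c ≠ ∞ := fun c hc => by
    obtain ⟨M, hM'⟩ := (hM.eventually_const_lt hD).exists
    exact ((lintegral_stoppingRule_le Q hZ hZi hc (Nat.cast_nonneg M) hM').trans_lt
      ENNReal.ofReal_lt_top).ne
  have hreal : Tendsto (fun c : ℝ => (e c).toReal * D / c) atTop (𝓝 1) := by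
    refine tendsto_order.2 ⟨fun a ha => ?_, fun a ha => ?_⟩
    -- Fix ε small enough that the limiting slope exceeds a, then let c grow so that the constant 2K
    -- becomes negligible.
    · have hlim : Tendsto (fun ε : ℝ => (1 - ε) / (D + 2 * ε) * D) (𝓝[>] 0) (𝓝 1) := by
        have : ContinuousAt (fun ε : ℝ => (1 - ε) / (D + 2 * ε) * D) 0 := by
          refine ContinuousAt.mul (ContinuousAt.div (by fun_prop) (by fun_prop) ?_) (by fun_prop)
          simpa using hD.ne'
        have h := this.tendsto
        simp only [sub_zero, mul_zero, add_zero, one_div, inv_mul_cancel₀ hD.ne'] at h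
        exact h.mono_left nhdsWithin_le_nhds
      obtain ⟨ε, h1, h2, h3⟩ := ((hlim.eventually_const_lt ha).and
        (Ioc_mem_nhdsGT (zero_lt_one (α := ℝ)))).exists
      obtain ⟨K, hK⟩ := exists_le_lintegral_stoppingRule Q hZ hZi hD h2 h3
      have h4 := tendsto_affine_div (-(2 * (K : ℝ))) D (k := (1 - ε) / (D + 2 * ε))
      filter_upwards [h4.eventually_const_lt h1, eventually_gt_atTop 0] with c hc hc0
      refine hc.trans_le ?_
      have h5 := (ENNReal.ofReal_le_iff_le_toReal (hfin c hc0)).1 (hK c)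
      have h6 : (1 - ε) / (D + 2 * ε) * (c + -(2 * K)) ≤ (e c).toReal := by
        refine le_of_eq_of_le ?_ h5
        ring
      gcongr
    -- Symmetrically, M is fixed first, and the overshoot M vanishes relative to c.
    · have hlim : Tendsto (fun M : ℕ => (∫ x, min (Z x) M ∂Q)⁻¹ * D) atTop (𝓝 1) := by
        have h := (hM.inv₀ hD.ne').mul_const D
        rwa [inv_mul_cancel₀ hD.ne'] at h
      obtain ⟨M, h1, h2⟩ := ((hlim.eventually_lt_const ha).and
        (hM.eventually_const_lt hD)).exists
      have h4 := tendsto_affine_div (M : ℝ) D (k := (∫ x, min (Z x) M ∂Q)⁻¹)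
      filter_upwards [h4.eventually_lt_const h1, eventually_gt_atTop 0] with c hc hc0
      refine lt_of_le_of_lt ?_ hc
      have h5 := lintegral_stoppingRule_le Q hZ hZi hc0 (Nat.cast_nonneg M) h2
      have h6 : (e c).toReal ≤ (∫ x, min (Z x) M ∂Q)⁻¹ * (c + M) := by
        refine (ENNReal.toReal_mono ENNReal.ofReal_ne_top h5).trans_eq ?_
        rw [ENNReal.toReal_ofReal (by positivity), div_eq_inv_mul]
      gcongr
  rw [← ENNReal.ofReal_one]
  refine (ENNReal.tendsto_ofReal hreal).congr' ?_
  filter_upwards [eventually_gt_atTop 0] with c hc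
  have h : (e c).toReal * D / c = (e c).toReal / (c / D) := by field_simp
  rw [h, ENNReal.ofReal_div_of_pos (by positivity), ENNReal.ofReal_toReal (hfin c hc),
    ENNReal.ofReal_div_of_pos hD]

end RunLength

end DiffusionCusum

theorem theorem3 {d w : ℕ} (pInf p1 : Density d) (m : E d → Matrix (Fin d) (Fin w) ℝ)
    (hne : pInf.law ≠ p1.law)
    (hreg : RegularPair m pInf p1) (hreg' : RegularPair m p1 pInf)
    (hpos : 0 < diffusionDivergence m pInf p1) (hpos' : 0 < diffusionDivergence m p1 pInf)
    (hmom : ∫⁻ x, ENNReal.ofReal (hyvScore m pInf x ^ 2) ∂p1.law < ∞)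
    (hmom' : ∫⁻ x, ENNReal.ofReal (hyvScore m p1 x ^ 2) ∂p1.law < ∞) :
    Tendsto
      (fun c : ℝ =>
        wadd pInf.law p1.law (stoppingRule (detScore m pInf p1) c) /
          (ENNReal.ofReal c / diffusionDivergence m p1 pInf))
      atTop (𝓝 1) := by
  have hZ : Measurable (detScore m pInf p1) := (continuous_detScore hreg hreg').measurable
  have hD := diffusionDivergence_eq_integral_detScore hreg hreg' hmom hmom'
  rw [hD] at hpos' ⊢
  simp_rw [wadd_stoppingRule pInf.law p1.law hZ]
  exact tendsto_lintegral_stoppingRule p1.law hZ (integrable_detScore hreg hreg' hmom hmom')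
    (ENNReal.ofReal_pos.1 hpos')
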